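/- Let $K$ be an algebraically closed field of arbitrary characteristic. By a projective variety over $K$ we mean a reduced $K$-scheme that admits a closed immersion over $K$ into $\mathbb{P}^n_K$ for some $n \ge 0$; all rational maps are over $K$. Let $X$ be an irreducible projective variety over $K$, let $\mathrm{Bir}(X)$ be the group (under composition) of birational self-maps of $X$, and let $G \subseteq \mathrm{Bir}(X)$ be a finite subgroup. Then there exist an irreducible projective variety $Y$ over $K$ and a birational map $\varphi : X \dashrightarrow Y$ such that for every $g \in G$ the birational self-map $\varphi \circ g \circ \varphi^{-1}$ of $Y$ is an automorphism of $Y$ over $K$ (that is, the rational map induced by an isomorphism of $K$-schemes $Y \to Y$). -/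

import Mathlib

universe u

open CategoryTheory AlgebraicGeometry

namespace BirReg

noncomputable section

attribute [local instance] MvPolynomial.gradedAlgebra

/-- Projective `n`-space over `K`, namely `Proj K[x₀, …, xₙ]` with the standard grading. -/
def projectiveSpace (K : Type u) [Field K] (n : ℕ) : Scheme.{u} :=
  Proj (MvPolynomial.homogeneousSubmodule (Fin (n + 1)) K)

/-- The structure morphism `ℙⁿ_K ⟶ Spec K`. -/
def projectiveSpaceToSpec (K : Type u) [Field K] (n : ℕ) :
    projectiveSpace K n ⟶ Spec (.of K) :=
  Proj.toSpecZero (MvPolynomial.homogeneousSubmodule (Fin (n + 1)) K) ≫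
    Spec.map (CommRingCat.ofHom
      (algebraMap K (MvPolynomial.homogeneousSubmodule (Fin (n + 1)) K 0)))

instance (K : Type u) [Field K] (n : ℕ) : (projectiveSpace K n).Over (Spec (.of K)) :=
  ⟨projectiveSpaceToSpec K n⟩

/-- A projective variety over `K`: a reduced `K`-scheme admitting a closed immersion over `K`
into some `ℙⁿ_K`. It is then automatically separated and of finite type over `K`.
Irreducibility is a separate condition. -/
structure IsProjectiveVariety (K : Type u) [Field K] (X : Scheme.{u}) [X.Over (Spec (.of K))] :
    Prop where
  isReduced : IsReduced X
  exists_closedImmersion : ∃ (n : ℕ) (i : X ⟶ projectiveSpace K n),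
    IsClosedImmersion i ∧ i.IsOver (Spec (.of K))

/-- A birational map over `S` between irreducible `S`-schemes: a dominant rational map over `S`
with a dominant rational inverse over `S`. (`f.comp g` is `f` followed by `g`. Between irreducible
schemes, density of the image already makes preimages of dense opens dense.) -/
@[ext]
structure BirationalMap (S X Y : Scheme.{u}) [X.Over S] [Y.Over S]
    [IrreducibleSpace X] [IrreducibleSpace Y] where
  /-- The underlying rational map. -/
  toRationalMap : X ⤏ Y
  isDominant : toRationalMap.IsDominant
  isOver : toRationalMap.IsOver S
  exists_inverse : ∃ (g : Y ⤏ X) (_ : g.IsDominant), g.IsOver S ∧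
    toRationalMap.comp g = Scheme.RationalMap.id X ∧
    g.comp toRationalMap = Scheme.RationalMap.id Y

namespace BirationalMap

attribute [instance] BirationalMap.isDominant BirationalMap.isOver

variable {S X Y Z : Scheme.{u}} [X.Over S] [Y.Over S] [Z.Over S]
  [IrreducibleSpace X] [IrreducibleSpace Y] [IrreducibleSpace Z]

/-- An isomorphism of `S`-schemes, viewed as a birational map over `S`. -/
def ofIso (a : X ≅ Y) (ha : a.hom.IsOver S) : BirationalMap S X Y where
  toRationalMap := a.hom.toRationalMap
  isDominant := inferInstance
  isOver := inferInstance
  exists_inverse := by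
    have : a.inv.IsOver S := ⟨by rw [Iso.inv_comp_eq]; exact ha.1.symm⟩
    refine ⟨a.inv.toRationalMap, inferInstance, inferInstance, ?_, ?_⟩
    · rw [Scheme.RationalMap.comp_toRationalMap, ← Scheme.RationalMap.compHom_toRationalMap,
        Scheme.Hom.toPartialMap_compHom, Iso.hom_inv_id]
    · rw [Scheme.RationalMap.comp_toRationalMap, ← Scheme.RationalMap.compHom_toRationalMap,
        Scheme.Hom.toPartialMap_compHom, Iso.inv_hom_id]

/-- The identity birational map. -/
def refl (S X : Scheme.{u}) [X.Over S] [IrreducibleSpace X] : BirationalMap S X X :=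
  ofIso (Iso.refl X) ⟨by simp⟩

/-- The inverse of a birational map. -/
def symm (f : BirationalMap S X Y) : BirationalMap S Y X where
  toRationalMap := f.exists_inverse.choose
  isDominant := f.exists_inverse.choose_spec.choose
  isOver := f.exists_inverse.choose_spec.choose_spec.1
  exists_inverse := ⟨f.toRationalMap, f.isDominant, f.isOver,
    f.exists_inverse.choose_spec.choose_spec.2.2, f.exists_inverse.choose_spec.choose_spec.2.1⟩

lemma comp_symm (f : BirationalMap S X Y) :
    f.toRationalMap.comp f.symm.toRationalMap = Scheme.RationalMap.id X :=
  f.exists_inverse.choose_spec.choose_spec.2.1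

lemma symm_comp (f : BirationalMap S X Y) :
    f.symm.toRationalMap.comp f.toRationalMap = Scheme.RationalMap.id Y :=
  f.exists_inverse.choose_spec.choose_spec.2.2

/-- The composite of two birational maps: `f` followed by `g`. -/
def trans (f : BirationalMap S X Y) (g : BirationalMap S Y Z) : BirationalMap S X Z where
  toRationalMap := f.toRationalMap.comp g.toRationalMap
  isDominant := inferInstance
  isOver := inferInstance
  exists_inverse := by
    refine ⟨g.symm.toRationalMap.comp f.symm.toRationalMap, inferInstance, inferInstance, ?_, ?_⟩
    · rw [Scheme.RationalMap.comp_assoc, ← Scheme.RationalMap.comp_assoc g.toRationalMap]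
      simp only [comp_symm, Scheme.RationalMap.id_comp]
    · rw [Scheme.RationalMap.comp_assoc, ← Scheme.RationalMap.comp_assoc f.symm.toRationalMap]
      simp only [symm_comp, Scheme.RationalMap.id_comp]

end BirationalMap

/-- The set `Bir(X)` of birational self-maps of `X` over `S`. -/
abbrev Bir (S X : Scheme.{u}) [X.Over S] [IrreducibleSpace X] : Type u := BirationalMap S X X

/-- `Bir(X)` is a group under composition, `f * g` being `f ∘ g`. -/
instance (S X : Scheme.{u}) [X.Over S] [IrreducibleSpace X] : Group (Bir S X) where
  mul f g := g.trans f
  one := BirationalMap.refl S X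
  inv f := f.symm
  mul_assoc f g h := BirationalMap.ext (Scheme.RationalMap.comp_assoc _ _ _).symm
  one_mul f := BirationalMap.ext (Scheme.RationalMap.comp_id f.toRationalMap)
  mul_one f := BirationalMap.ext (Scheme.RationalMap.id_comp f.toRationalMap)
  inv_mul_cancel f := BirationalMap.ext f.comp_symm

/-- A birational self-map is an automorphism if it is induced by an isomorphism of `S`-schemes
`X ≅ X`. -/
def Bir.IsAutomorphism {S X : Scheme.{u}} [X.Over S] [IrreducibleSpace X] (f : Bir S X) : Prop :=
  ∃ (a : X ≅ X) (ha : a.hom.IsOver S), f = BirationalMap.ofIso a ha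

/-- The birational self-map `φ ∘ f ∘ φ⁻¹` of `Y` obtained from `f ∈ Bir(X)` by transport along
the birational map `φ : X ⤏ Y`. -/
def Bir.transport {S X Y : Scheme.{u}} [X.Over S] [Y.Over S] [IrreducibleSpace X]
    [IrreducibleSpace Y] (φ : BirationalMap S X Y) (f : Bir S X) : Bir S Y :=
  (φ.symm.trans f).trans φ

end

end BirReg

/-! A finite group of birational maps becomes a group of coordinate permutations once the
coordinates are chosen `G`-stably. Pullback makes `G` act on the function field `L` of `X` by
`K`-automorphisms, contravariantly. Choose finitely many field generators `f i` of `L` over `K` and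
take all translates `g^*(f i)`. As `G` is finite, these and the constant `1` are the homogeneous
coordinates of an `L`-point of some projective space; let `Y` be its closure.

The coordinates generate `L`, so `Y` has function field `L` (`exists_functionField_iso`), and `X`
and `Y` are birational (`exists_birationalMap`). Each `g` permutes the coordinates, so the
corresponding permutation of projective space carries the `L`-point to its composite with `Spec` of
the pullback by `g`. It therefore preserves the closure `Y` (`exists_model_iso`). Since a rational
map from an integral scheme is determined by its restriction to the generic point, the resulting
automorphism of `Y` is the conjugate of `g` (`transport_isAutomorphism`). -/

namespace BirReg

/-! ### Rational maps and function fields -/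

/-- The closed point of the spectrum of a local ring, as a point of a scheme. -/
def closedPt (L : CommRingCat.{u}) [IsLocalRing L] : Spec L := IsLocalRing.closedPoint L

lemma fromSpecStalk_closedPt {X : Scheme.{u}} (x : X) : X.fromSpecStalk x (closedPt _) = x :=
  Scheme.fromSpecStalk_closedPoint

lemma SpecMap_closedPt {R L : CommRingCat.{u}} [IsLocalRing R] [IsLocalRing L] (γ : R ⟶ L)
    [IsLocalHom γ.hom] : Spec.map γ (closedPt L) = closedPt R :=
  Spec_closedPoint

/-- A morphism from the spectrum of a local ring whose closed point maps to `y` factors through `Spec 𝒪_y`. -/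
lemma exists_SpecMap_fromSpecStalk_eq {L : CommRingCat.{u}} [IsLocalRing L] {Y : Scheme.{u}}
    (f : Spec L ⟶ Y) {y : Y} (h : f (closedPt L) = y) :
    ∃ γ : Y.presheaf.stalk y ⟶ L, Spec.map γ ≫ Y.fromSpecStalk y = f := by
  subst h
  exact ⟨_, Scheme.Spec_stalkClosedPointTo_fromSpecStalk f⟩

/-- The generic point is preserved by dominant morphisms. -/
lemma map_genericPoint_of_isDominant {X Y : Scheme.{u}} [IrreducibleSpace X] [IrreducibleSpace Y]
    (f : X ⟶ Y) [IsDominant f] : f (genericPoint X) = genericPoint Y := by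
  refine IsGenericPoint.eq ?_ (genericPoint_spec Y)
  have := (genericPoint_spec X).image f.continuous
  rwa [Set.image_univ, f.denseRange.closure_eq] at this

lemma irreducibleSpace_opens {X : Scheme.{u}} [IrreducibleSpace X] (U : X.Opens)
    (hU : Dense (U : Set X)) : IrreducibleSpace U.toScheme :=
  { isPreirreducible_univ := Subtype.preirreducibleSpace
      ((PreirreducibleSpace.isPreirreducible_univ (X := X)).open_subset U.2
        (Set.subset_univ _)) |>.isPreirreducible_univ
    toNonempty := hU.nonempty.to_subtype }

lemma partialMap_fromFunctionField_closedPoint {X Y : Scheme.{u}} [IsIntegral X]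
    [IrreducibleSpace Y] (f : X.PartialMap Y) [IsDominant f.hom] :
    f.fromFunctionField (closedPt X.functionField) = genericPoint Y := by
  have := irreducibleSpace_opens f.domain f.dense_domain
  rw [← map_genericPoint_of_isDominant f.hom, Scheme.PartialMap.fromFunctionField,
    Scheme.PartialMap.fromSpecStalkOfMem, Scheme.Hom.comp_apply]
  congr 1
  apply f.domain.ι.isOpenEmbedding.injective
  rw [← Scheme.Hom.comp_apply, Scheme.Opens.fromSpecStalkOfMem_ι,
    fromSpecStalk_closedPt, genericPoint_eq_of_isOpenImmersion]

/-- The map on spectra of function fields induced by a dominant rational map. -/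
lemma exists_functionField_map {X Y : Scheme.{u}} [IsIntegral X] [IrreducibleSpace Y]
    (f : X ⤏ Y) [f.IsDominant] :
    ∃ γ : Y.functionField ⟶ X.functionField,
      Spec.map γ ≫ Y.fromSpecStalk _ = f.fromFunctionField := by
  rw [← f.toRationalMap_representative, Scheme.RationalMap.fromFunctionField_toRationalMap]
  exact exists_SpecMap_fromSpecStalk_eq _ (partialMap_fromFunctionField_closedPoint _)

/-- Maps on function fields compose as the rational maps do. -/
lemma fromFunctionField_comp {X Y Z : Scheme.{u}} [IsIntegral X] [IrreducibleSpace Y]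
    (f : X ⤏ Y) [f.IsDominant] (g : Y ⤏ Z) (γ : Y.functionField ⟶ X.functionField)
    (hγ : Spec.map γ ≫ Y.fromSpecStalk _ = f.fromFunctionField) :
    (f.comp g).fromFunctionField = Spec.map γ ≫ g.fromFunctionField := by
  obtain ⟨f, rfl, hf⟩ : ∃ f' : X.PartialMap Y, f'.toRationalMap = f ∧ IsDominant f'.hom :=
    ⟨f.representative, f.toRationalMap_representative, inferInstance⟩
  obtain ⟨g, rfl⟩ := g.exists_rep
  rw [Scheme.RationalMap.toRationalMap_comp]
  simp only [Scheme.RationalMap.fromFunctionField_toRationalMap] at hγ ⊢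
  -- Arbitrary points `x`, `y` and arbitrary membership proofs keep the dependent types manageable;
  -- the generic points are the case needed.
  have key : ∀ (x : X) (hx : x ∈ (f.comp g).domain) (hx' : x ∈ f.domain) (y : Y)
      (hy : y ∈ g.domain) (γ : Y.presheaf.stalk y ⟶ X.presheaf.stalk x)
      (_ : Spec.map γ ≫ Y.fromSpecStalk y = f.fromSpecStalkOfMem hx'),
      (f.comp g).fromSpecStalkOfMem hx = Spec.map γ ≫ g.fromSpecStalkOfMem hy := by
    intro x hx hx' y hy γ hγ
    let W := f.domain.ι ''ᵁ f.hom ⁻¹ᵁ g.domain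
    have hxW : x ∈ W := hx
    change W.fromSpecStalkOfMem x hxW ≫ (f.domain.ι.isoImage _).inv ≫
      f.hom ∣_ g.domain ≫ g.hom = Spec.map γ ≫ g.domain.fromSpecStalkOfMem y hy ≫ g.hom
    have h1 : W.fromSpecStalkOfMem x hxW ≫ (f.domain.ι.isoImage (f.hom ⁻¹ᵁ g.domain)).inv ≫
        (f.hom ⁻¹ᵁ g.domain).ι = f.domain.fromSpecStalkOfMem x hx' := by
      rw [← cancel_mono f.domain.ι, Category.assoc, Category.assoc,
        Scheme.Hom.isoImage_inv_ι, Scheme.Opens.fromSpecStalkOfMem_ι]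
      exact (Scheme.Opens.fromSpecStalkOfMem_ι f.domain x hx').symm
    have h2 : W.fromSpecStalkOfMem x hxW ≫ (f.domain.ι.isoImage (f.hom ⁻¹ᵁ g.domain)).inv ≫
        f.hom ∣_ g.domain = Spec.map γ ≫ g.domain.fromSpecStalkOfMem y hy := by
      rw [← cancel_mono g.domain.ι, Category.assoc, Category.assoc, Category.assoc,
        morphismRestrict_ι, reassoc_of% h1, Scheme.Opens.fromSpecStalkOfMem_ι, hγ,
        Scheme.PartialMap.fromSpecStalkOfMem]
    rw [← reassoc_of% h2]
  exact key _ _ _ _ _ γ hγ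

lemma fromFunctionField_toRationalMap {X Y : Scheme.{u}} [IrreducibleSpace X] (f : X ⟶ Y) :
    (Scheme.Hom.toRationalMap f).fromFunctionField = X.fromSpecStalk _ ≫ f := by
  rw [Scheme.RationalMap.fromFunctionField_toRationalMap]
  exact Scheme.PartialMap.fromSpecStalkOfMem_toPartialMap f _

lemma isOver_fromFunctionField {S X Y : Scheme.{u}} [X.Over S] [Y.Over S] [IsIntegral X]
    (f : X ⤏ Y) [f.IsOver S] :
    f.fromFunctionField ≫ Y ↘ S = X.fromSpecStalk _ ≫ X ↘ S := by
  obtain ⟨g, hg, rfl⟩ := f.exists_partialMap_over S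
  rw [Scheme.RationalMap.fromFunctionField_toRationalMap, Scheme.PartialMap.fromFunctionField,
    Scheme.PartialMap.fromSpecStalkOfMem, Category.assoc, hg.1]
  exact Scheme.Opens.fromSpecStalkOfMem_ι_assoc _ _ _ _

/-- Locality of `γ` sends the closed point to the generic point of `Y`, which therefore lies in the
image of any representative and is already dense. -/
lemma isDominant_of_fromFunctionField {X Y : Scheme.{u}} [IsIntegral X] [IrreducibleSpace Y]
    (f : X ⤏ Y) (γ : Y.functionField ⟶ X.functionField)
    (hγ : Spec.map γ ≫ Y.fromSpecStalk _ = f.fromFunctionField) [IsLocalHom γ.hom] :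
    f.IsDominant := by
  obtain ⟨f, rfl⟩ := f.exists_rep
  rw [Scheme.PartialMap.isDominant_toRationalMap_iff]
  rw [Scheme.RationalMap.fromFunctionField_toRationalMap] at hγ
  have h1 : (Spec.map γ ≫ Y.fromSpecStalk _) (closedPt X.functionField) =
      genericPoint Y := by
    rw [Scheme.Hom.comp_apply, SpecMap_closedPt, fromSpecStalk_closedPt]
  rw [hγ, Scheme.PartialMap.fromFunctionField, Scheme.PartialMap.fromSpecStalkOfMem,
    Scheme.Hom.comp_apply] at h1
  refine ⟨(dense_iff_closure_eq.mpr (genericPoint_spec Y)).mono ?_⟩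
  rintro _ rfl
  exact ⟨_, h1⟩

/-- An isomorphism of function fields over `S` is induced by a birational map over `S`. -/
lemma exists_birationalMap {S X Y : Scheme.{u}} [X.Over S] [Y.Over S] [IsIntegral X]
    [IsIntegral Y] [LocallyOfFiniteType (X ↘ S)] [LocallyOfFiniteType (Y ↘ S)]
    (e : Y.functionField ≅ X.functionField)
    (he : Spec.map e.hom ≫ Y.fromSpecStalk _ ≫ Y ↘ S = X.fromSpecStalk _ ≫ X ↘ S) :
    ∃ φ : BirationalMap S X Y,
      φ.toRationalMap.fromFunctionField = Spec.map e.hom ≫ Y.fromSpecStalk _ := by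
  have he' : Spec.map e.inv ≫ X.fromSpecStalk _ ≫ X ↘ S = Y.fromSpecStalk _ ≫ Y ↘ S := by
    rw [← he, ← Spec.map_comp_assoc, e.hom_inv_id]
    simp
  have hf0 : (Spec.map e.hom ≫ Y.fromSpecStalk _) ≫ Y ↘ S = X.fromSpecStalk _ ≫ X ↘ S := by
    rw [Category.assoc, he]
  have hg0 : (Spec.map e.inv ≫ X.fromSpecStalk _) ≫ X ↘ S = Y.fromSpecStalk _ ≫ Y ↘ S := by
    rw [Category.assoc, he']
  -- Being locally of finite type over `S` lets a morphism from the generic point spread out to a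
  -- dense open.
  let f : X ⤏ Y := .ofFunctionField (X ↘ S) (Y ↘ S) (Spec.map e.hom ≫ Y.fromSpecStalk _)
    hf0
  let g : Y ⤏ X := .ofFunctionField (Y ↘ S) (X ↘ S) (Spec.map e.inv ≫ X.fromSpecStalk _)
    hg0
  have hf : f.fromFunctionField = Spec.map e.hom ≫ Y.fromSpecStalk _ :=
    Scheme.RationalMap.fromFunctionField_ofFunctionField ..
  have hg : g.fromFunctionField = Spec.map e.inv ≫ X.fromSpecStalk _ :=
    Scheme.RationalMap.fromFunctionField_ofFunctionField ..
  have : f.IsDominant := isDominant_of_fromFunctionField f e.hom hf.symm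
  have : g.IsDominant := isDominant_of_fromFunctionField g e.inv hg.symm
  have hfo : f.IsOver S := by
    rw [Scheme.RationalMap.isOver_iff]
    exact (Scheme.RationalMap.equivFunctionField (X ↘ S) (Y ↘ S) ⟨_, hf0⟩).2
  have hgo : g.IsOver S := by
    rw [Scheme.RationalMap.isOver_iff]
    exact (Scheme.RationalMap.equivFunctionField (Y ↘ S) (X ↘ S) ⟨_, hg0⟩).2
  refine ⟨⟨f, inferInstance, hfo, g, inferInstance, hgo, ?_, ?_⟩, hf⟩
  · apply Scheme.RationalMap.eq_of_fromFunctionField_eq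
    rw [fromFunctionField_comp f g e.hom hf.symm, hg, ← Spec.map_comp_assoc, e.inv_hom_id,
      fromFunctionField_toRationalMap]
    simp
  · apply Scheme.RationalMap.eq_of_fromFunctionField_eq
    rw [fromFunctionField_comp g f e.inv hg.symm, hf, ← Spec.map_comp_assoc, e.hom_inv_id,
      fromFunctionField_toRationalMap]
    simp


/-! ### Scheme-theoretic images and their automorphisms -/

/-- The scheme-theoretic image of a reduced scheme is reduced. -/
lemma isReduced_image {X Y : Scheme.{u}} (f : X ⟶ Y) [QuasiCompact f] [IsReduced X] :
    IsReduced f.image := by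
  have hU : (⨆ U : Y.affineOpens, f.imageι ⁻¹ᵁ U.1) = ⊤ := by
    rw [← Scheme.Hom.preimage_iSup, iSup_affineOpens_eq_top]
    rfl
  have (U : Y.affineOpens) : IsReduced (f.imageι ⁻¹ᵁ U.1).toScheme := by
    have : IsAffine (f.imageι ⁻¹ᵁ U.1).toScheme := U.2.preimage f.imageι
    -- Over an affine open of `Y`, functions on the image embed into functions on the reduced scheme
    -- `X`.
    have h1 : _root_.IsReduced Γ(f.image, f.imageι ⁻¹ᵁ U.1) :=
      isReduced_of_injective _ (f.toImage_app_injective U)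
    have : _root_.IsReduced Γ((f.imageι ⁻¹ᵁ U.1).toScheme, ⊤) :=
      isReduced_of_injective _
        ((f.imageι ⁻¹ᵁ U.1).topIso).commRingCatIsoToRingEquiv.injective
    exact isReduced_of_isAffine_isReduced _
  have : ∀ i, IsReduced ((f.image.openCoverOfIsOpenCover _ hU).X i) := this
  exact .of_openCover _ (f.image.openCoverOfIsOpenCover _ hU)

/-- The scheme-theoretic image of an irreducible scheme is irreducible. -/
lemma irreducibleSpace_image {X Y : Scheme.{u}} (f : X ⟶ Y) [QuasiCompact f]
    [IrreducibleSpace X] : IrreducibleSpace f.image := by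
  have h := (PreirreducibleSpace.isPreirreducible_univ (X := X)).image f.toImage
    f.toImage.continuous.continuousOn
  rw [Set.image_univ] at h
  have h2 := h.closure
  rw [f.toImage.denseRange.closure_eq] at h2
  exact { isPreirreducible_univ := h2
          toNonempty := ‹IrreducibleSpace X›.toNonempty.map f.toImage }

/-- A morphism of the target that is compatible with `f` induces one of the image of `f`. -/
lemma exists_image_map {X Y : Scheme.{u}} (f : X ⟶ Y) [QuasiCompact f] [IsReduced X]
    (γ : X ⟶ X) (σ : Y ⟶ Y) (h : f ≫ σ = γ ≫ f) :
    ∃ τ : f.image ⟶ f.image, τ ≫ f.imageι = f.imageι ≫ σ := by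
  have := isReduced_image f
  -- `p` is the closed subscheme of the image that `σ` sends back into the image. By `l` it contains
  -- the dense image of `X`, so it is everything, the image being reduced.
  let p := Limits.pullback.fst (f.imageι ≫ σ) f.imageι
  let l : X ⟶ Limits.pullback (f.imageι ≫ σ) f.imageι :=
    Limits.pullback.lift f.toImage (γ ≫ f.toImage) (by simp [h])
  have hl : l ≫ p = f.toImage := Limits.pullback.lift_fst _ _ _
  have hp : Surjective p := by
    refine ⟨Set.range_eq_univ.mp ?_⟩
    rw [← p.isClosedEmbedding.isClosed_range.closure_eq]
    refine Dense.closure_eq (f.toImage.denseRange.mono ?_)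
    rw [← hl]
    rintro _ ⟨x, rfl⟩
    exact ⟨l x, by simp⟩
  have : IsIso p := isIso_of_isClosedImmersion_of_surjective p
  exact ⟨inv p ≫ Limits.pullback.snd _ _, by
    rw [Category.assoc, ← Limits.pullback.condition, IsIso.inv_hom_id_assoc]⟩

/-- An automorphism of the target that is compatible with `f` induces one of the image of `f`. -/
lemma exists_image_iso {X Y : Scheme.{u}} (f : X ⟶ Y) [QuasiCompact f] [IsReduced X]
    (γ : X ≅ X) (σ : Y ≅ Y) (h : f ≫ σ.hom = γ.hom ≫ f) :
    ∃ τ : f.image ≅ f.image, τ.hom ≫ f.imageι = f.imageι ≫ σ.hom := by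
  obtain ⟨τ, hτ⟩ := exists_image_map f γ.hom σ.hom h
  obtain ⟨τ', hτ'⟩ := exists_image_map f γ.inv σ.inv
    (by rw [← cancel_mono σ.hom, Category.assoc, Category.assoc, h]; simp)
  refine ⟨⟨τ, τ', ?_, ?_⟩, hτ⟩
  · rw [← cancel_mono f.imageι, Category.assoc, hτ', reassoc_of% hτ]
    simp
  · rw [← cancel_mono f.imageι, Category.assoc, hτ, reassoc_of% hτ']
    simp


/-! ### Points of `Proj` and maps induced by graded homomorphisms -/

section Proj

variable {A B : Type u} [CommRing A] [CommRing B] {σ τ : Type u} [SetLike σ A]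
  [AddSubgroupClass σ A] [SetLike τ B] [AddSubgroupClass τ B] (𝒜 : ℕ → σ) (ℬ : ℕ → τ)
  [GradedRing 𝒜] [GradedRing ℬ] {L M : Type u} [CommRing L] [CommRing M]

/-- The homomorphism on the degree-zero part of `A[1/s]` induced by a homomorphism from `A`
sending `s` to `1`. -/
noncomputable def awayEval (φ : A →+* L) (s : A) (h : φ s = 1) :
    HomogeneousLocalization.Away 𝒜 s →+* L :=
  (IsLocalization.Away.lift (S := Localization.Away s) s
    (g := φ) (by rw [h]; exact isUnit_one)).comp
    (algebraMap (HomogeneousLocalization.Away 𝒜 s) (Localization.Away s))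

lemma awayEval_mk (φ : A →+* L) (s : A) (h : φ s = 1) {d : ℕ} (hs : s ∈ 𝒜 d) (n : ℕ) (x : A)
    (hx : x ∈ 𝒜 (n • d)) :
    awayEval 𝒜 φ s h (.mk 𝒜 hs n x hx) = φ x := by
  have hu : IsUnit (φ s) := by rw [h]; exact isUnit_one
  have : (Localization.mk x ⟨s ^ n, ⟨n, rfl⟩⟩ : Localization.Away s) *
      algebraMap A _ (s ^ n) = algebraMap A _ x := by
    rw [Localization.mk_eq_mk']
    exact IsLocalization.mk'_spec _ x (⟨s ^ n, ⟨n, rfl⟩⟩ : Submonoid.powers s)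
  have h2 := congr(IsLocalization.Away.lift (S := Localization.Away s) s hu $this)
  rw [map_mul, IsLocalization.Away.lift_eq, IsLocalization.Away.lift_eq, map_pow, h, one_pow,
    mul_one] at h2
  exact h2

/-- The `L`-point of `Proj A` given by a homomorphism `A → L` sending `s` to `1`. -/
noncomputable def projPoint (φ : A →+* L) (s : A) (h : φ s = 1) (hs : s ∈ 𝒜 1) :
    Spec (.of L) ⟶ Proj 𝒜 :=
  Spec.map (CommRingCat.ofHom (awayEval 𝒜 φ s h)) ≫ Proj.awayι 𝒜 s hs one_pos

lemma projPoint_congr {φ φ' : A →+* L} {s s' : A} (hφ : φ = φ') (hs : s = s') (h : φ s = 1)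
    (h' : s ∈ 𝒜 1) :
    projPoint 𝒜 φ s h h' = projPoint 𝒜 φ' s' (by rw [← hφ, ← hs, h]) (by rwa [← hs]) := by
  subst hφ hs
  rfl

lemma SpecMap_projPoint (φ : A →+* L) (s : A) (h : φ s = 1) (hs : s ∈ 𝒜 1) (ψ : L →+* M) :
    Spec.map (CommRingCat.ofHom ψ) ≫ projPoint 𝒜 φ s h hs =
      projPoint 𝒜 (ψ.comp φ) s (by simp [h]) hs := by
  rw [projPoint, projPoint, ← Spec.map_comp_assoc, ← CommRingCat.ofHom_comp]
  congr 3
  ext x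
  obtain ⟨n, a, ha, rfl⟩ := HomogeneousLocalization.Away.mk_surjective 𝒜 hs x
  simp only [RingHom.comp_apply, awayEval_mk]

lemma projPoint_map (f : 𝒜 →+*ᵍ ℬ)
    (hf : HomogeneousIdeal.irrelevant ℬ ≤ (HomogeneousIdeal.irrelevant 𝒜).map f)
    (φ : B →+* L) (s : A) (h : φ (f s) = 1) (hs : s ∈ 𝒜 1) :
    projPoint ℬ φ (f s) h (f.2 hs) ≫ Proj.map f hf =
      projPoint 𝒜 (φ.comp f.toRingHom) s h hs := by
  rw [projPoint, projPoint, Category.assoc, Proj.awayι_comp_map f hf one_pos s hs,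
    ← Spec.map_comp_assoc, ← CommRingCat.ofHom_comp]
  congr 3
  ext x
  obtain ⟨n, a, ha, rfl⟩ := HomogeneousLocalization.Away.mk_surjective 𝒜 hs x
  rw [RingHom.comp_apply, HomogeneousLocalization.Away.map_mk, awayEval_mk, awayEval_mk]
  rfl

lemma projPoint_toSpecZero (φ : A →+* L) (s : A) (h : φ s = 1) (hs : s ∈ 𝒜 1) :
    projPoint 𝒜 φ s h hs ≫ Proj.toSpecZero 𝒜 =
      Spec.map (CommRingCat.ofHom (φ.comp (algebraMap (𝒜 0) A))) := by
  rw [projPoint, Category.assoc, Proj.awayι_toSpecZero, ← Spec.map_comp, ← CommRingCat.ofHom_comp]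
  congr 2
  ext x
  have : HomogeneousLocalization.fromZeroRingHom 𝒜 (.powers s) x =
      HomogeneousLocalization.Away.mk 𝒜 hs 0 x.1 (by simp) := by
    ext
    simp [HomogeneousLocalization.fromZeroRingHom]
    rfl
  rw [RingHom.comp_apply, this, awayEval_mk]
  rfl

variable {𝒜 ℬ}

/-- A graded section `g` exhibits every element of positive degree as a value of `f` on one. This is
the condition for `Proj.map f` to be defined everywhere. -/
lemma irrelevant_le_map_of_comp_eq_id (f : 𝒜 →+*ᵍ ℬ) (g : ℬ →+*ᵍ 𝒜) (h : f.comp g = .id ℬ) :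
    HomogeneousIdeal.irrelevant ℬ ≤ (HomogeneousIdeal.irrelevant 𝒜).map f := by
  rw [HomogeneousIdeal.irrelevant_le]
  intro i hi x hx
  have hx' : x = f (g x) := (DFunLike.congr_fun h x).symm
  rw [hx']
  exact Ideal.mem_map_of_mem f (HomogeneousIdeal.mem_irrelevant_of_mem 𝒜 hi (g.2 hx))

/-- Mutually inverse graded homomorphisms induce an isomorphism on `Proj`. -/
noncomputable def projIso (f : 𝒜 →+*ᵍ ℬ) (g : ℬ →+*ᵍ 𝒜) (h : f.comp g = .id ℬ)
    (h' : g.comp f = .id 𝒜) : Proj ℬ ≅ Proj 𝒜 where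
  hom := Proj.map f (irrelevant_le_map_of_comp_eq_id f g h)
  inv := Proj.map g (irrelevant_le_map_of_comp_eq_id g f h')
  hom_inv_id := by
    rw [← Proj.map_comp, ← Proj.map_id]
    congr 1
  inv_hom_id := by
    rw [← Proj.map_comp, ← Proj.map_id]
    congr 1

end Proj

/-! ### Coordinate points and permutations of projective space -/

section ProjectiveSpace

attribute [local instance] MvPolynomial.gradedAlgebra

variable (K : Type u) [Field K] (n : ℕ)

/-- Renaming of variables as a graded homomorphism. -/
noncomputable def renameGraded {ι κ : Type*} (s : ι → κ) :
    MvPolynomial.homogeneousSubmodule ι K →+*ᵍ MvPolynomial.homogeneousSubmodule κ K where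
  __ := (MvPolynomial.rename s : MvPolynomial ι K →ₐ[K] MvPolynomial κ K).toRingHom
  map_mem h := MvPolynomial.IsHomogeneous.rename_isHomogeneous h

lemma renameGraded_comp_eq_id {ι κ : Type*} (s : ι → κ) (t : κ → ι) (h : t ∘ s = id) :
    (renameGraded K t).comp (renameGraded K s) = .id _ := by
  refine DFunLike.ext _ _ fun x ↦ ?_
  change MvPolynomial.rename t (MvPolynomial.rename s x) = x
  rw [MvPolynomial.rename_rename, h, MvPolynomial.rename_id_apply]

lemma X_mem_homogeneousSubmodule {ι : Type*} (i : ι) :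
    (MvPolynomial.X i : MvPolynomial ι K) ∈ MvPolynomial.homogeneousSubmodule ι K 1 :=
  MvPolynomial.isHomogeneous_X K i

lemma C_mem_homogeneousSubmodule {ι : Type*} (a : K) :
    (MvPolynomial.C a : MvPolynomial ι K) ∈ MvPolynomial.homogeneousSubmodule ι K 0 :=
  MvPolynomial.isHomogeneous_C _ a

/-- The automorphism of projective space permuting the coordinates. -/
noncomputable def permIso (s : Equiv.Perm (Fin (n + 1))) :
    projectiveSpace K n ≅ projectiveSpace K n :=
  projIso (renameGraded K s) (renameGraded K s.symm)
    (renameGraded_comp_eq_id K _ _ s.self_comp_symm)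
    (renameGraded_comp_eq_id K _ _ s.symm_comp_self)

lemma algebraMap_zero_surjective :
    Function.Surjective
      (algebraMap K (MvPolynomial.homogeneousSubmodule (Fin (n + 1)) K 0)) := by
  rintro ⟨x, hx⟩
  obtain ⟨a, rfl⟩ : ∃ a, MvPolynomial.C a = x := by
    refine ⟨_, ((MvPolynomial.totalDegree_eq_zero_iff_eq_C).mp ?_).symm⟩
    exact Nat.le_zero.mp (MvPolynomial.IsHomogeneous.totalDegree_le hx)
  exact ⟨a, rfl⟩

instance locallyOfFiniteType_projectiveSpace :
    LocallyOfFiniteType (projectiveSpace K n ↘ Spec (.of K)) := by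
  have h0 : (algebraMap K (MvPolynomial (Fin (n + 1)) K)).FiniteType :=
    (RingHom.finiteType_algebraMap (A := K)).mpr inferInstance
  have : Algebra.FiniteType (MvPolynomial.homogeneousSubmodule (Fin (n + 1)) K 0)
      (MvPolynomial (Fin (n + 1)) K) :=
    RingHom.FiniteType.of_comp_finiteType
      (f := algebraMap K (MvPolynomial.homogeneousSubmodule (Fin (n + 1)) K 0))
      (g := algebraMap _ (MvPolynomial (Fin (n + 1)) K))
      h0 |> RingHom.finiteType_algebraMap.mp
  have h1 : LocallyOfFiniteType
      (Spec.map (CommRingCat.ofHom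
        (algebraMap K (MvPolynomial.homogeneousSubmodule (Fin (n + 1)) K 0)))) := by
    rw [HasRingHomProperty.Spec_iff (P := @LocallyOfFiniteType)]
    exact RingHom.FiniteType.of_surjective _ (algebraMap_zero_surjective K n)
  exact inferInstanceAs (LocallyOfFiniteType (Proj.toSpecZero _ ≫ _))

variable {n} {L : Type u} [CommRing L] (κ : K →+* L) (v : Fin (n + 1) → L) (hv : v 0 = 1)

/-- The point with homogeneous coordinates `v`, where `v 0 = 1`. -/
noncomputable def coordPoint : Spec (.of L) ⟶ projectiveSpace K n :=
  projPoint (MvPolynomial.homogeneousSubmodule (Fin (n + 1)) K) (MvPolynomial.eval₂Hom κ v)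
    (MvPolynomial.X 0) (by simp [hv]) (X_mem_homogeneousSubmodule K 0)

lemma coordPoint_over :
    coordPoint K κ v hv ≫ projectiveSpace K n ↘ Spec (.of K) =
      Spec.map (CommRingCat.ofHom κ) := by
  change _ ≫ Proj.toSpecZero _ ≫ _ = _
  refine (Category.assoc _ _ _).symm.trans ?_
  rw [coordPoint, projPoint_toSpecZero, ← Spec.map_comp, ← CommRingCat.ofHom_comp]
  congr 2
  ext x
  exact MvPolynomial.eval₂Hom_C κ v x

/-- Both sides are the point with coordinates `v ∘ s`. Fixing the index `0` keeps the normalizing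
coordinate equal to `1`. -/
lemma coordPoint_permIso (s : Equiv.Perm (Fin (n + 1))) (hs : s 0 = 0) (ψ : L →+* L)
    (hκ : ψ.comp κ = κ) (hψ : ∀ i, ψ (v i) = v (s i)) :
    coordPoint K κ v hv ≫ (permIso K n s).hom =
      Spec.map (CommRingCat.ofHom ψ) ≫ coordPoint K κ v hv := by
  have hX : MvPolynomial.X 0 = renameGraded K s (MvPolynomial.X 0) := by
    change _ = MvPolynomial.rename s _
    rw [MvPolynomial.rename_X, hs]
  refine Eq.trans ?_ (SpecMap_projPoint _ _ _ _ _ _).symm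
  rw [coordPoint, projPoint_congr _ rfl hX]
  refine (projPoint_map _ _ (renameGraded K s) _ _ _ _
    (X_mem_homogeneousSubmodule K 0)).trans (projPoint_congr _ ?_ rfl _ _)
  ext x
  · change MvPolynomial.eval₂Hom κ v (MvPolynomial.rename s (MvPolynomial.C x)) =
      ψ (MvPolynomial.eval₂Hom κ v (MvPolynomial.C x))
    rw [MvPolynomial.rename_C, MvPolynomial.coe_eval₂Hom, MvPolynomial.eval₂_C,
      ← RingHom.comp_apply, hκ]
  · change MvPolynomial.eval₂Hom κ v (MvPolynomial.rename s (MvPolynomial.X x)) =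
      ψ (MvPolynomial.eval₂Hom κ v (MvPolynomial.X x))
    simp [hψ]

/-- A homomorphism through whose spectrum `coordPoint` factors has the constants and the
coordinates in its range. -/
lemma mem_range_of_factors {L : Type u} [CommRing L] [IsLocalRing L] (κ : K →+* L) (v : Fin (n + 1) → L)
    (hv : v 0 = 1) {F : CommRingCat.{u}} [IsLocalRing F] (ε : F ⟶ .of L) [IsLocalHom ε.hom]
    (q : Spec F ⟶ Proj (MvPolynomial.homogeneousSubmodule (Fin (n + 1)) K))
    (h : Spec.map ε ≫ q = coordPoint K κ v hv) :
    (∀ a, κ a ∈ ε.hom.range) ∧ ∀ i, v i ∈ ε.hom.range := by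
  let 𝒜 := MvPolynomial.homogeneousSubmodule (Fin (n + 1)) K
  have h0 : MvPolynomial.X 0 ∈ 𝒜 1 := X_mem_homogeneousSubmodule K 0
  have hv' : MvPolynomial.eval₂Hom κ v (MvPolynomial.X 0) = 1 := by simp [hv]
  let ι := Proj.awayι 𝒜 (MvPolynomial.X 0) h0 one_pos
  have hq : q (closedPt F) ∈ ι.opensRange := by
    rw [← SpecMap_closedPt ε, ← Scheme.Hom.comp_apply, h]
    exact ⟨Spec.map (CommRingCat.ofHom (awayEval 𝒜 (MvPolynomial.eval₂Hom κ v) _ hv'))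
      (closedPt (.of L)), by rw [← Scheme.Hom.comp_apply]; rfl⟩
  -- Every point of a local spectrum specializes to the closed point, so all of `Spec F` lands in
  -- the chart where the coordinate of index `0` is invertible.
  have hq' : Set.range q ⊆ Set.range ι := by
    rintro _ ⟨x, rfl⟩
    exact ((IsLocalRing.specializes_closedPoint x).map q.continuous).mem_open
      ι.opensRange.2 hq
  obtain ⟨θ, hθ⟩ := Spec.map_surjective (IsOpenImmersion.lift ι q hq')
  have hθ' : θ ≫ ε = CommRingCat.ofHom (awayEval 𝒜 (MvPolynomial.eval₂Hom κ v) _ hv') := by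
    apply Spec.map_injective
    rw [← cancel_mono ι, Spec.map_comp, Category.assoc, hθ, IsOpenImmersion.lift_fac, h]
    rfl
  -- A form `x` of degree `d` evaluates at `v` as the function `x / X₀ ^ d` does, because `v 0 = 1`.
  -- Degrees `0` and `1` give the constants and the coordinates.
  have key (d : ℕ) (x) (hx : x ∈ 𝒜 (d • 1)) : MvPolynomial.eval₂Hom κ v x ∈ ε.hom.range := by
    rw [← awayEval_mk 𝒜 _ _ hv' h0 d x hx]
    exact ⟨θ.hom _, congr($(hθ').hom _)⟩
  refine ⟨fun a ↦ ?_, fun i ↦ ?_⟩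
  · simpa using key 0 (MvPolynomial.C a) (C_mem_homogeneousSubmodule K a)
  · simpa using key 1 (MvPolynomial.X i) (X_mem_homogeneousSubmodule K i)

end ProjectiveSpace


/-! ### Finite generation of the function field -/

/-- A subring is closed under the inverses that exist in the ambient ring. -/
def IsInverseClosed {L : Type*} [CommRing L] (R : Subring L) : Prop :=
  ∀ x ∈ R, ∀ y, x * y = 1 → y ∈ R

/-- The function field of an integral scheme locally of finite type over a field `K` is finitely
generated as a field extension of `K`. -/
lemma exists_generators {K : Type u} [Field K] {X : Scheme.{u}} [X.Over (Spec (.of K))]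
    [IsIntegral X] [LocallyOfFiniteType (X ↘ Spec (.of K))] (κ : CommRingCat.of K ⟶ X.functionField)
    (hκ : Spec.map κ = X.fromSpecStalk _ ≫ X ↘ Spec (.of K)) :
    ∃ (m : ℕ) (f : Fin m → X.functionField), ∀ R : Subring X.functionField, IsInverseClosed R →
      (∀ a, κ.hom a ∈ R) → (∀ i, f i ∈ R) → R = ⊤ := by
  obtain ⟨_, ⟨U, hU, rfl⟩, hxU, -⟩ := X.isBasis_affineOpens.exists_subset_of_mem_open
    (Set.mem_univ (genericPoint X)) isOpen_univ
  have hU : IsAffineOpen U := hU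
  have : Nonempty U := ⟨⟨_, hxU⟩⟩
  obtain ⟨ρ, hρ⟩ := Spec.map_surjective (hU.fromSpec ≫ X ↘ Spec (.of K))
  have hρκ : κ = ρ ≫ X.germToFunctionField U := by
    apply Spec.map_injective
    rw [hκ, Spec.map_comp, hρ, ← hU.fromSpecStalk_eq_fromSpecStalk hxU]
    exact Category.assoc (Spec.map (X.germToFunctionField U)) hU.fromSpec _
  have hft : ρ.hom.FiniteType := by
    rw [← HasRingHomProperty.Spec_iff (P := @LocallyOfFiniteType), hρ]
    exact MorphismProperty.comp_mem @LocallyOfFiniteType _ _ inferInstance inferInstance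
  algebraize [ρ.hom]
  obtain ⟨T, hT⟩ := hft.out
  refine ⟨T.card, fun i ↦ X.germToFunctionField U (T.equivFin.symm i).1, fun R hR h1 h2 ↦ ?_⟩
  -- The chosen elements generate the coordinate ring of an affine open as an algebra; fractions
  -- then give the whole function field.
  have hS (x : Γ(X, U)) : X.germToFunctionField U x ∈ R := by
    have hx : x ∈ Algebra.adjoin K (T : Set Γ(X, U)) := by rw [hT]; trivial
    induction hx using Algebra.adjoin_induction with
    | mem x hx => simpa using h2 (T.equivFin ⟨x, hx⟩)
    | algebraMap a =>
      have := h1 a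
      rwa [hρκ] at this
    | add x y _ _ hx hy => rw [map_add]; exact R.add_mem hx hy
    | mul x y _ _ hx hy => rw [map_mul]; exact R.mul_mem hx hy
  refine top_le_iff.mp fun z _ ↦ ?_
  have := functionField_isFractionRing_of_isAffineOpen X U hU
  obtain ⟨⟨a, b⟩, hab⟩ := IsLocalization.surj (nonZeroDivisors Γ(X, U)) z
  obtain ⟨c, hc⟩ := (IsLocalization.map_units X.functionField b).exists_right_inv
  have hz : z = algebraMap Γ(X, U) X.functionField a * c := by
    rw [← hab, mul_assoc, hc, mul_one]
  rw [hz]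
  exact R.mul_mem (hS a) (hR _ (hS b) _ hc)

/-! ### The projective model attached to a coordinate point -/

section Model

attribute [local instance] MvPolynomial.gradedAlgebra

variable (K : Type u) [Field K] {n : ℕ} {L : Type u} [CommRing L]
  (κ : K →+* L) (v : Fin (n + 1) → L) (hv : v 0 = 1)

/-- The closure of the point with homogeneous coordinates `v`. -/
noncomputable abbrev model : Scheme.{u} := (coordPoint K κ v hv).image

noncomputable instance : (model K κ v hv).Over (Spec (.of K)) :=
  ⟨(coordPoint K κ v hv).imageι ≫ projectiveSpace K n ↘ Spec (.of K)⟩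

lemma toImage_over : (coordPoint K κ v hv).toImage ≫ model K κ v hv ↘ Spec (.of K) =
    Spec.map (CommRingCat.ofHom κ) := by
  rw [← coordPoint_over K κ v hv]
  exact Scheme.Hom.toImage_imageι_assoc _ _

instance quasiCompact_coordPoint : QuasiCompact (coordPoint K κ v hv) := by
  have : Scheme.IsSeparated (projectiveSpace K n) :=
    inferInstanceAs (Scheme.IsSeparated
      (Proj (MvPolynomial.homogeneousSubmodule (Fin (n + 1)) K)))
  infer_instance

variable [IsDomain L]

instance : IrreducibleSpace (model K κ v hv) := irreducibleSpace_image _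

instance : LocallyOfFiniteType (model K κ v hv ↘ Spec (.of K)) :=
  MorphismProperty.comp_mem @LocallyOfFiniteType (coordPoint K κ v hv).imageι
    (projectiveSpace K n ↘ Spec (.of K)) inferInstance inferInstance

lemma isProjectiveVariety_model : IsProjectiveVariety K (model K κ v hv) where
  isReduced := isReduced_image _
  exists_closedImmersion := ⟨n, (coordPoint K κ v hv).imageι, inferInstance, ⟨rfl⟩⟩

instance : IsIntegral (model K κ v hv) :=
  have := isReduced_image (coordPoint K κ v hv)
  isIntegral_of_irreducibleSpace_of_isReduced _

/-- The coordinate point hits the generic point of its closure, so it embeds the function field of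
the model into `L`. The range contains the constants and the coordinates and is closed under
inverses, hence is all of `L`. -/
lemma exists_functionField_iso (hL : IsField L)
    (hgen : ∀ R : Subring L, IsInverseClosed R → (∀ a, κ a ∈ R) → (∀ i, v i ∈ R) → R = ⊤) :
    ∃ e : (model K κ v hv).functionField ≅ .of L,
      Spec.map e.hom ≫ (model K κ v hv).fromSpecStalk _ = (coordPoint K κ v hv).toImage := by
  let j := coordPoint K κ v hv
  have : IsLocalRing L := @Field.instIsLocalRing L hL.toField
  have hj : j.toImage (closedPt (.of L)) = genericPoint (model K κ v hv) := by
    rw [← map_genericPoint_of_isDominant j.toImage]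
    congr 1
    let := hL.toField
    exact Subsingleton.elim (α := PrimeSpectrum L) _ _
  obtain ⟨ε, hε⟩ := exists_SpecMap_fromSpecStalk_eq _ hj
  have hloc : IsLocalHom ε.hom := by
    refine ⟨fun a ha ↦ ?_⟩
    refine isUnit_iff_ne_zero.mpr ?_
    rintro rfl
    rw [map_zero] at ha
    exact not_isUnit_zero ha
  have h := mem_range_of_factors K κ v hv ε
    ((model K κ v hv).fromSpecStalk _ ≫ j.imageι) 
    ((Category.assoc (Spec.map ε) (j.image.fromSpecStalk _) j.imageι).symm.trans
      ((congrArg (· ≫ j.imageι) hε).trans j.toImage_imageι))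
  have hinv : IsInverseClosed ε.hom.range := by
    rintro _ ⟨x, rfl⟩ y hy
    have hx : IsUnit x := isUnit_of_map_unit ε.hom _ (.of_mul_eq_one _ hy)
    obtain ⟨z, hz⟩ := hx.exists_right_inv
    refine ⟨z, ?_⟩
    have hz' : ε.hom x * ε.hom z = 1 := by rw [← map_mul, hz, map_one]
    exact (left_inv_eq_right_inv (by rw [mul_comm]; exact hz') hy)
  have hsurj : Function.Surjective ε.hom :=
    RingHom.range_eq_top.mp (hgen _ hinv h.1 h.2)
  have hbij : Function.Bijective ε.hom := ⟨ε.hom.injective, hsurj⟩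
  exact ⟨(RingEquiv.ofBijective ε.hom hbij).toCommRingCatIso, hε⟩

/-- A ring automorphism permuting the coordinates induces an automorphism of the model. -/
lemma exists_model_iso (s : Equiv.Perm (Fin (n + 1))) (hs : s 0 = 0)
    (ψ : CommRingCat.of L ≅ CommRingCat.of L) (hκ : ψ.hom.hom.comp κ = κ)
    (hψ : ∀ i, ψ.hom.hom (v i) = v (s i)) :
    ∃ τ : model K κ v hv ≅ model K κ v hv, τ.hom.IsOver (Spec (.of K)) ∧
      (coordPoint K κ v hv).toImage ≫ τ.hom =
        Spec.map ψ.hom ≫ (coordPoint K κ v hv).toImage := by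
  have key : coordPoint K κ v hv ≫ (permIso K n s).hom =
      Spec.map ψ.hom ≫ coordPoint K κ v hv := coordPoint_permIso K κ v hv s hs ψ.hom.hom hκ hψ
  obtain ⟨τ, hτ⟩ := exists_image_iso (coordPoint K κ v hv) (Scheme.Spec.mapIso ψ.op)
    (permIso K n s) key
  have hτ' : (coordPoint K κ v hv).toImage ≫ τ.hom =
      Spec.map ψ.hom ≫ (coordPoint K κ v hv).toImage := by
    rw [← cancel_mono (coordPoint K κ v hv).imageι, Category.assoc, hτ, Category.assoc,
      Scheme.Hom.toImage_imageι, Scheme.Hom.toImage_imageι_assoc, key]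
  refine ⟨τ, ⟨?_⟩, hτ'⟩
  -- The model is reduced and `Spec K` is separated, so compatibility with the structure maps can be
  -- tested on the dense coordinate point.
  refine ext_of_isDominant (ι := (coordPoint K κ v hv).toImage) ?_
  rw [reassoc_of% hτ', toImage_over, ← Spec.map_comp]
  congr 1
  ext x
  exact congr($hκ x)

end Model

/-! ### Conjugation and the action on the function field -/

/-- Conjugation by `φ` turns the action on the function field of `X` into that of an automorphism
`τ` of `Y`. -/
lemma transport_isAutomorphism {S X Y : Scheme.{u}} [X.Over S] [Y.Over S] [IsIntegral X]
    [IsIntegral Y] (φ : BirationalMap S X Y) (g : Bir S X) (γ : X.functionField ⟶ X.functionField)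
    (hγ : Spec.map γ ≫ X.fromSpecStalk _ = g.toRationalMap.fromFunctionField) (τ : Y ≅ Y)
    (hτ : τ.hom.IsOver S)
    (h : φ.toRationalMap.fromFunctionField ≫ τ.hom =
      Spec.map γ ≫ φ.toRationalMap.fromFunctionField) :
    (Bir.transport φ g).IsAutomorphism := by
  refine ⟨τ, hτ, BirationalMap.ext (Scheme.RationalMap.eq_of_fromFunctionField_eq _ _ ?_)⟩
  obtain ⟨δ, hδ⟩ := exists_functionField_map φ.symm.toRationalMap
  have hδφ : Spec.map δ ≫ φ.toRationalMap.fromFunctionField = Y.fromSpecStalk _ := by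
    rw [← fromFunctionField_comp _ _ δ hδ, φ.symm_comp, fromFunctionField_toRationalMap,
      Category.comp_id]
  have h1 : Spec.map (γ ≫ δ) ≫ X.fromSpecStalk _ =
      (φ.symm.toRationalMap.comp g.toRationalMap).fromFunctionField := by
    rw [fromFunctionField_comp _ _ δ hδ, Spec.map_comp, Category.assoc, hγ]
  change ((φ.symm.toRationalMap.comp g.toRationalMap).comp φ.toRationalMap).fromFunctionField =
    (Scheme.Hom.toRationalMap τ.hom).fromFunctionField
  rw [fromFunctionField_comp _ _ _ h1, fromFunctionField_toRationalMap, Spec.map_comp,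
    Category.assoc, ← h, reassoc_of% hδφ]

section Action

variable {S X : Scheme.{u}} [X.Over S] [IsIntegral X]

/-- The action of a birational self-map on the function field. -/
noncomputable def pullback (g : Bir S X) : X.functionField ⟶ X.functionField :=
  (exists_functionField_map g.toRationalMap).choose

lemma SpecMap_pullback (g : Bir S X) :
    Spec.map (pullback g) ≫ X.fromSpecStalk _ = g.toRationalMap.fromFunctionField :=
  (exists_functionField_map g.toRationalMap).choose_spec

lemma pullback_one : pullback (1 : Bir S X) = 𝟙 _ := by
  apply Spec.map_injective
  rw [← cancel_mono (X.fromSpecStalk (genericPoint X)), SpecMap_pullback]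
  refine (fromFunctionField_toRationalMap (𝟙 X)).trans ?_
  simp

/-- Pullback reverses composition: `g * h` applies `h` first, whereas functions are pulled back
along `g` first. -/
lemma pullback_mul (g h : Bir S X) : pullback (g * h) = pullback g ≫ pullback h := by
  apply Spec.map_injective
  rw [← cancel_mono (X.fromSpecStalk (genericPoint X)), SpecMap_pullback]
  refine (fromFunctionField_comp h.toRationalMap g.toRationalMap _ (SpecMap_pullback h)).trans ?_
  rw [Spec.map_comp, Category.assoc, SpecMap_pullback]

/-- The automorphism of the function field given by a birational self-map. -/
noncomputable def pullbackIso (g : Bir S X) : X.functionField ≅ X.functionField where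
  hom := pullback g
  inv := pullback g⁻¹
  hom_inv_id := by rw [← pullback_mul, mul_inv_cancel, pullback_one]
  inv_hom_id := by rw [← pullback_mul, inv_mul_cancel, pullback_one]

lemma SpecMap_pullback_over (g : Bir S X) :
    Spec.map (pullback g) ≫ X.fromSpecStalk _ ≫ X ↘ S = X.fromSpecStalk _ ≫ X ↘ S := by
  rw [← Category.assoc, SpecMap_pullback, isOver_fromFunctionField]

end Action

end BirReg

/-! ### The `G`-stable choice of coordinates -/

theorem proposition2p17 (K : Type u) [Field K] [IsAlgClosed K]
    (X : Scheme.{u}) [X.Over (Spec (.of K))]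
    [IrreducibleSpace X] (hX : BirReg.IsProjectiveVariety K X)
    (G : Subgroup (BirReg.Bir (Spec (.of K)) X)) [Finite G] :
    ∃ (Y : Scheme.{u}) (_ : Y.Over (Spec (.of K)))
      (_ : IrreducibleSpace Y),
      BirReg.IsProjectiveVariety K Y ∧
      ∃ φ : BirReg.BirationalMap (Spec (.of K)) X Y,
        ∀ g ∈ G, (BirReg.Bir.transport φ g).IsAutomorphism := by
  open BirReg in
  have := hX.isReduced
  have : IsIntegral X := isIntegral_of_irreducibleSpace_of_isReduced X
  obtain ⟨N, i, hi, hiS⟩ := hX.exists_closedImmersion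
  have : LocallyOfFiniteType (X ↘ Spec (.of K)) := by
    rw [← hiS.1]
    infer_instance
  obtain ⟨κ, hκ⟩ := Spec.map_surjective (X.fromSpecStalk (genericPoint X) ≫ X ↘ Spec (.of K))
  have hκg (g : Bir (Spec (.of K)) X) : κ ≫ pullback g = κ := by
    apply Spec.map_injective
    rw [Spec.map_comp, hκ, SpecMap_pullback_over]
  obtain ⟨m, f, hf⟩ := exists_generators κ hκ
  -- `none` indexes the coordinate `1` and goes to `0`; `some (a, i)` indexes the translate of `f i`
  -- by `a`.
  let E : Option (G × Fin m) ≃ Fin (Nat.card (G × Fin m) + 1) :=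
    (Equiv.optionCongr (Finite.equivFin _)).trans (finSuccEquiv _).symm
  have hE : E none = 0 := by simp [E]
  let w : Option (G × Fin m) → X.functionField :=
    fun o ↦ o.elim 1 fun p ↦ (pullback p.1.1).hom (f p.2)
  let v : Fin (Nat.card (G × Fin m) + 1) → X.functionField := w ∘ E.symm
  have hv : v 0 = 1 := by simp [v, w, ← hE]
  have hvE (o) : v (E o) = w o := by simp [v]
  have hL : IsField X.functionField := Field.toIsField _
  -- The translates by `a = 1` are the `f i` themselves, so the coordinates generate.
  obtain ⟨e, he⟩ := exists_functionField_iso K κ.hom v hv hL (by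
    intro R hR h1 h2
    refine hf R hR h1 fun i ↦ ?_
    have := h2 (E (some (1, i)))
    rw [hvE] at this
    simpa [w, pullback_one] using this)
  have hsY : Spec.map e.hom ≫ (model K κ.hom v hv).fromSpecStalk _ ≫
      model K κ.hom v hv ↘ Spec (.of K) = X.fromSpecStalk _ ≫ X ↘ Spec (.of K) := by
    rw [reassoc_of% he, ← hκ]
    exact toImage_over K κ.hom v hv
  obtain ⟨φ, hφ⟩ := exists_birationalMap (S := Spec (.of K)) (X := X) e hsY
  refine ⟨model K κ.hom v hv, inferInstance, inferInstance,
    isProjectiveVariety_model K κ.hom v hv, φ, fun g hg ↦ ?_⟩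
  -- Right multiplication, since pulling back by `a` and then by `g` is pulling back by `a * g`.
  let t : Option (G × Fin m) ≃ Option (G × Fin m) :=
    Equiv.optionCongr (Equiv.prodCongr (Equiv.mulRight ⟨g, hg⟩) (Equiv.refl _))
  obtain ⟨τ, hτS, hτ⟩ := exists_model_iso K κ.hom v hv ((E.symm.trans t).trans E)
    (by simp [← hE, t]) (pullbackIso g) congr(($(hκg g)).hom) (by
      intro i
      obtain ⟨o, rfl⟩ := E.surjective i
      simp only [Equiv.trans_apply, Equiv.symm_apply_apply, hvE]
      obtain _ | ⟨a, i⟩ := o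
      · simp [w, t]
      · simp only [w, t, Option.elim_some, Equiv.optionCongr_apply, Option.map_some,
          Equiv.prodCongr_apply, Prod.map_apply, Equiv.coe_mulRight, Subgroup.coe_mul,
          pullback_mul]
        rfl)
  refine transport_isAutomorphism φ g (pullback g) (SpecMap_pullback g) τ hτS ?_
  rw [hφ, he]
  exact hτ
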